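/- Let $\mathcal D$ be a triangulated category with Grothendieck group $K(\mathcal D)$, and let $\sigma=(Z,\mathcal P)$ be a (Bridgeland) stability condition on $\mathcal D$: that is, $Z\colon K(\mathcal D)\to\mathbb C$ is a group homomorphism and $\mathcal P(\phi)\subset\mathcal D$ ($\phi\in\mathbb R$) is a family of full additive subcategories, closed under isomorphism, such that (a) if $0\neq E\in\mathcal P(\phi)$, then $Z(E)=m(E)\exp(i\pi\phi)$ for some $m(E)\in\mathbb R_{>0}$; (b) $\mathcal P(\phi+1)=\mathcal P(\phi)[1]$ for all $\phi\in\mathbb R$; (c) if $\phi_1>\phi_2$ and $A_i\in\mathcal P(\phi_i)$ $(i=1,2)$, then $\operatorname{Hom}_{\mathcal D}(A_1,A_2)=0$; (d) every $0\neq E\in\mathcal D$ has a Harder–Narasimhan filtration, i.e. there are real numbers $\phi_1>\dots>\phi_m$ and exact triangles $E_{i-1}\to E_i\to A_i\to E_{i-1}[1]$ $(i=1,\dots,m)$ with $E_0=0$, $E_m=E$ and $A_i\in\mathcal P(\phi_i)$ for all $i$. For $t\in\mathbb R$ and $0\ne E\in\mathcal D$ with Harder–Narasimhan factors $A_1,\dots,A_m$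 of phases $\phi_1>\dots>\phi_m$, the mass of $E$ with parameter $t$ is $$m_{\sigma,t}(E):=\sum_{i=1}^m |Z(A_i)|\,e^{\phi_i t},$$ and $m_{\sigma,t}(E):=0$ if $E\cong 0$. Proposition. For all objects $D,E,F\in\mathcal D$, if there is an exact triangle $D\to E\to F\to D[1]$, then for every $t\in\mathbb R$ $$m_{\sigma,t}(E)\le m_{\sigma,t}(D)+m_{\sigma,t}(F).$$ -/

import Mathlib

open CategoryTheory CategoryTheory.Limits CategoryTheory.Pretriangulated

universe v u

noncomputable section

namespace BridgelandStability

variable (C : Type u) [Category.{v} C] [HasZeroObject C] [Preadditive C] [HasShift C ℤ]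
  [∀ n : ℤ, (shiftFunctor C n).Additive] [Pretriangulated C]

/-- The subgroup of relations `[Y] = [X] + [Z]`, one for each distinguished triangle
`X ⟶ Y ⟶ Z ⟶ X⟦1⟧`, in the free abelian group on the objects of `C`. -/
def triangleRelations : AddSubgroup (FreeAbelianGroup C) :=
  AddSubgroup.closure {x | ∃ T ∈ distTriang C,
    x = FreeAbelianGroup.of T.obj₂ - FreeAbelianGroup.of T.obj₁ - FreeAbelianGroup.of T.obj₃}

/-- The Grothendieck group `K(C)` of a triangulated category. -/
abbrev GrothendieckGroup : Type u := FreeAbelianGroup C ⧸ triangleRelations C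

variable {C}

/-- The class `[X]` of an object in the Grothendieck group. -/
def classOf (X : C) : GrothendieckGroup C :=
  QuotientAddGroup.mk (FreeAbelianGroup.of X)

/-- A Harder-Narasimhan filtration of `E` with respect to a family `P φ` of full subcategories:
a finite sequence of distinguished triangles `E_i ⟶ E_{i+1} ⟶ A_i ⟶ E_i⟦1⟧` (`0 ≤ i < n`) with
`E_0 = 0`, `E_n ≅ E`, and `A_i ∈ P (φ_i)` for real numbers `φ_0 > φ_1 > ... > φ_{n-1}`. -/
structure HNFiltration (P : ℝ → ObjectProperty C) (E : C) where
  /-- the number of factors -/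
  n : ℕ
  /-- the objects `E_0, ..., E_n` -/
  obj : Fin (n + 1) → C
  /-- the factors -/
  factor : Fin n → C
  /-- the phases of the factors -/
  phase : Fin n → ℝ
  /-- the map `E_i ⟶ E_{i+1}` -/
  ι (i : Fin n) : obj i.castSucc ⟶ obj i.succ
  /-- the map `E_{i+1} ⟶ A_i` -/
  π (i : Fin n) : obj i.succ ⟶ factor i
  /-- the map `A_i ⟶ E_i⟦1⟧` -/
  δ (i : Fin n) : factor i ⟶ (obj i.castSucc)⟦(1 : ℤ)⟧
  distinguished (i : Fin n) : Triangle.mk (ι i) (π i) (δ i) ∈ distTriang C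
  isZero_obj_zero : IsZero (obj 0)
  /-- the last object of the filtration is `E` -/
  lastIso : obj (Fin.last n) ≅ E
  phase_strictAnti : StrictAnti phase
  factor_mem (i : Fin n) : P (phase i) (factor i)

variable (C)

/-- A (Bridgeland) stability condition `(Z, P)` on a triangulated category `C`. -/
structure StabilityCondition where
  /-- the central charge -/
  Z : GrothendieckGroup C →+ ℂ
  /-- the full subcategory `P φ` of semistable objects of phase `φ` (and zero objects) -/
  P : ℝ → ObjectProperty C
  closedUnderIso (φ : ℝ) : (P φ).IsClosedUnderIsomorphisms
  zero_mem (φ : ℝ) (X : C) : IsZero X → P φ X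
  biprod_mem (φ : ℝ) (X Y : C) : P φ X → P φ Y → P φ (X ⊞ Y)
  /-- `Z(E) = m exp(iπφ)` with `m > 0` for nonzero `E ∈ P φ` -/
  central_charge (φ : ℝ) (E : C) : P φ E → ¬ IsZero E →
    ∃ m : ℝ, 0 < m ∧ Z (classOf E) = m * Complex.exp (Complex.I * Real.pi * φ)
  /-- `P (φ + 1) = (P φ)⟦1⟧`, up to isomorphism of objects -/
  shift (φ : ℝ) (X : C) : P (φ + 1) X ↔ ∃ Y : C, P φ Y ∧ Nonempty (X ≅ Y⟦(1 : ℤ)⟧)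
  hom_eq_zero (φ₁ φ₂ : ℝ) (A₁ A₂ : C) : φ₂ < φ₁ → P φ₁ A₁ → P φ₂ A₂ → ∀ f : A₁ ⟶ A₂, f = 0
  exists_HN (E : C) : ¬ IsZero E → Nonempty (HNFiltration P E)

variable {C}

namespace StabilityCondition

/-- The sum `∑ |Z(A_i)| exp(φ_i t)` over the factors of a Harder-Narasimhan filtration.
Factors that are zero objects contribute `0`. -/
def massOfHN (σ : StabilityCondition C) (t : ℝ) {E : C} (H : HNFiltration σ.P E) : ℝ :=
  ∑ i : Fin H.n, ‖σ.Z (classOf (H.factor i))‖ * Real.exp (H.phase i * t)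

open Classical in
/-- The mass `m_{σ,t}(E)` of `E` with parameter `t`. The Harder-Narasimhan filtration of a nonzero
object is unique up to isomorphism (and zero factors), so the one chosen here does not matter. -/
def mass (σ : StabilityCondition C) (t : ℝ) (E : C) : ℝ :=
  if h : IsZero E then 0 else σ.massOfHN t (σ.exists_HN E h).some

end StabilityCondition

end BridgelandStability

end

/-! The mass is an average over hearts. For each real `a`, let H(E) be the part of E with phases in
(a, a+1], its degree-zero cohomology for the heart P((a, a+1]), and let `heartHeight a E` be
Im(exp(-iπa) Z(H(E))). A factor of phase φ contributes |Z| sin(π(φ-a)) if a < φ ≤ a+1 and nothing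
otherwise (`heartHeight_eq_sum`). Integrating against exp(at) and substituting u = φ-a gives the
mass times c(t) = ∫₀¹ sin(πu) exp(-ut) du > 0 (`integral_heartHeight`).

It therefore suffices that each `heartHeight a` is subadditive (`heartHeight_le`). This replaces
exactness of cohomology by truncations: octahedra reduce to E in the heart, where a sign count
suffices (`heartHeight_le_of_heart`). Heights depend on truncations alone, so the choice of
filtration in `mass` is harmless. -/

noncomputable section

namespace BridgelandStability

/-! ### Octahedral manipulations of triangles -/

section Triangles

open scoped ZeroObject

variable {C : Type u} [Category.{v} C] [HasZeroObject C] [Preadditive C] [HasShift C ℤ]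
  [∀ n : ℤ, (shiftFunctor C n).Additive] [Pretriangulated C]

/-- There is a distinguished triangle `X ⟶ Y ⟶ Z ⟶ X⟦1⟧`. -/
def IsTri (X Y Z : C) : Prop :=
  ∃ (f : X ⟶ Y) (g : Y ⟶ Z) (h : Z ⟶ X⟦(1 : ℤ)⟧), Triangle.mk f g h ∈ distTriang C

namespace IsTri

variable {X Y Z X' Y' Z' : C}

lemma congr (h : IsTri X Y Z) (e₁ : X ≅ X') (e₂ : Y ≅ Y') (e₃ : Z ≅ Z') : IsTri X' Y' Z' := by
  obtain ⟨f, g, δ, hT⟩ := h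
  refine ⟨e₁.inv ≫ f ≫ e₂.hom, e₂.inv ≫ g ≫ e₃.hom, e₃.inv ≫ δ ≫ e₁.hom⟦(1 : ℤ)⟧',
    isomorphic_distinguished _ hT _ (Triangle.isoMk _ _ e₁.symm e₂.symm e₃.symm ?_ ?_ ?_)⟩
  · change (e₁.inv ≫ f ≫ e₂.hom) ≫ e₂.inv = e₁.inv ≫ f
    simp
  · change (e₂.inv ≫ g ≫ e₃.hom) ≫ e₃.inv = e₂.inv ≫ g
    simp
  · change (e₃.inv ≫ δ ≫ e₁.hom⟦(1 : ℤ)⟧') ≫ e₁.inv⟦(1 : ℤ)⟧' = e₃.inv ≫ δ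
    simp

lemma rotate (h : IsTri X Y Z) : IsTri Y Z (X⟦(1 : ℤ)⟧) := by
  obtain ⟨f, g, δ, hT⟩ := h
  exact ⟨_, _, _, rot_of_distTriang _ hT⟩

lemma invRotate (h : IsTri X Y Z) : IsTri (Z⟦(-1 : ℤ)⟧) X Y := by
  obtain ⟨f, g, δ, hT⟩ := h
  exact ⟨_, _, _, inv_rot_of_distTriang _ hT⟩

lemma of_rotate (h : IsTri Y Z (X⟦(1 : ℤ)⟧)) : IsTri X Y Z :=
  h.invRotate.congr ((shiftEquiv C (1 : ℤ)).unitIso.app X).symm (Iso.refl _) (Iso.refl _)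

lemma shift (h : IsTri X Y Z) (n : ℤ) : IsTri (X⟦n⟧) (Y⟦n⟧) (Z⟦n⟧) := by
  obtain ⟨f, g, δ, hT⟩ := h
  exact ⟨_, _, _, Triangle.shift_distinguished _ hT n⟩

lemma of_isZero_right (hZ : IsZero Z) (e : X ≅ Y) : IsTri X Y Z :=
  (show IsTri X X 0 from ⟨_, _, _, contractible_distinguished X⟩).congr (Iso.refl _) e hZ.isoZero.symm

lemma of_isZero_left (hX : IsZero X) (e : Y ≅ Z) : IsTri X Y Z :=
  (show IsTri 0 Y Y from ⟨_, _, _, contractible_distinguished₁ Y⟩).congr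
    hX.isoZero.symm (Iso.refl _) e

lemma classOf_eq (h : IsTri X Y Z) : classOf Y = classOf X + classOf Z := by
  obtain ⟨f, g, δ, hT⟩ := h
  have : FreeAbelianGroup.of Y - FreeAbelianGroup.of X - FreeAbelianGroup.of Z ∈
      triangleRelations C := AddSubgroup.subset_closure ⟨_, hT, rfl⟩
  have h0 := (QuotientAddGroup.eq_zero_iff _).2 this
  rw [QuotientAddGroup.mk_sub, QuotientAddGroup.mk_sub, sub_sub, sub_eq_zero] at h0
  exact h0

variable [IsTriangulated C] {D E F A B : C}

/-- A subobject `A` of the subobject `D` of `E`. -/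
lemma assoc (h : IsTri D E F) (h' : IsTri A D B) : ∃ G, IsTri A E G ∧ IsTri B G F := by
  obtain ⟨f, g, δ, hT⟩ := h
  obtain ⟨f', g', δ', hT'⟩ := h'
  obtain ⟨G, p, q, hG⟩ := distinguished_cocone_triangle (f' ≫ f)
  exact ⟨G, ⟨_, _, _, hG⟩, ⟨_, _, _, (Triangulated.someOctahedron rfl hT' hT hG).mem⟩⟩

/-- A quotient `B` of the quotient `F` of `E`. -/
lemma assoc' (h : IsTri D E F) (h' : IsTri A F B) : ∃ G, IsTri G E B ∧ IsTri D G A := by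
  obtain ⟨f, g, δ, hT⟩ := h.rotate
  obtain ⟨f', g', δ', hT'⟩ := h'.rotate
  obtain ⟨G, p, q, hG⟩ := distinguished_cocone_triangle (f ≫ f')
  have hG₁ : IsTri E B G := ⟨_, _, _, hG⟩
  have hG₂ : IsTri (D⟦(1 : ℤ)⟧) G (A⟦(1 : ℤ)⟧) :=
    ⟨_, _, _, (Triangulated.someOctahedron rfl hT hT' hG).mem⟩
  exact ⟨_, hG₁.invRotate, (hG₂.shift (-1)).congr
    ((shiftEquiv C (1 : ℤ)).unitIso.app D).symm (Iso.refl _)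
    ((shiftEquiv C (1 : ℤ)).unitIso.app A).symm⟩

lemma pullback (h : IsTri D E F) (h' : IsTri A E B) : ∃ K, IsTri K A F ∧ IsTri K D B := by
  obtain ⟨f, g, δ, hT⟩ := h'
  obtain ⟨f', g', δ', hT'⟩ := h.rotate
  obtain ⟨G, p, q, hG⟩ := distinguished_cocone_triangle (f ≫ f')
  have h₁ : IsTri A F G := ⟨_, _, _, hG⟩
  have h₂ : IsTri B G (D⟦(1 : ℤ)⟧) := ⟨_, _, _, (Triangulated.someOctahedron rfl hT hT' hG).mem⟩
  exact ⟨_, h₁.invRotate, h₂.of_rotate.invRotate⟩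

lemma pushout (h : IsTri D E F) (h' : IsTri A E B) : ∃ K, IsTri D B K ∧ IsTri A F K := by
  obtain ⟨f, g, δ, hT⟩ := h
  obtain ⟨f', g', δ', hT'⟩ := h'.rotate
  obtain ⟨G, p, q, hG⟩ := distinguished_cocone_triangle (f ≫ f')
  have h₂ : IsTri F G (A⟦(1 : ℤ)⟧) := ⟨_, _, _, (Triangulated.someOctahedron rfl hT hT' hG).mem⟩
  exact ⟨G, ⟨_, _, _, hG⟩, h₂.of_rotate⟩

end IsTri

lemma classOf_isZero {X : C} (hX : IsZero X) : classOf X = 0 := by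
  simpa using (IsTri.of_isZero_left hX (Iso.refl X)).classOf_eq

lemma classOf_iso {X Y : C} (e : X ≅ Y) : classOf X = classOf Y := by
  have hz : IsZero (0 : C) := isZero_zero C
  simpa [classOf_isZero hz] using (IsTri.of_isZero_right hz e).classOf_eq.symm

end Triangles

/-! ### Extension closures of phase ranges -/

section ExtensionClosure

variable {C : Type u} [Category.{v} C] [HasZeroObject C] [Preadditive C] [HasShift C ℤ]
  [∀ n : ℤ, (shiftFunctor C n).Additive] [Pretriangulated C]

/-- The extension closure `P(I)` of the subcategories `P φ` with `φ ∈ I`. -/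
inductive ExtClosure (P : ℝ → ObjectProperty C) (I : Set ℝ) : C → Prop
  | of_isZero {X : C} : IsZero X → ExtClosure P I X
  | of_mem {φ : ℝ} {X : C} : φ ∈ I → P φ X → ExtClosure P I X
  | of_isTri {X Y Z : C} : IsTri X Y Z → ExtClosure P I X → ExtClosure P I Z → ExtClosure P I Y

namespace ExtClosure

variable {P : ℝ → ObjectProperty C} {I J : Set ℝ} {X Y Z : C}

lemma mono (hX : ExtClosure P I X) (hIJ : I ⊆ J) : ExtClosure P J X := by
  induction hX with
  | of_isZero h => exact of_isZero h
  | of_mem h h' => exact of_mem (hIJ h) h'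
  | of_isTri h _ _ h₁ h₂ => exact of_isTri h h₁ h₂

lemma shift {n : ℤ} (hP : ∀ φ X, P φ X → P (φ + n) (X⟦n⟧)) (hIJ : ∀ φ ∈ I, φ + n ∈ J)
    (hX : ExtClosure P I X) : ExtClosure P J (X⟦n⟧) := by
  induction hX with
  | of_isZero h => exact of_isZero (Functor.map_isZero _ h)
  | of_mem h h' => exact of_mem (hIJ _ h) (hP _ _ h')
  | of_isTri h _ _ h₁ h₂ => exact of_isTri (h.shift n) h₁ h₂

lemma gt_of_gt_add_one {a : ℝ} (hX : ExtClosure P (Set.Ioi (a + 1)) X) :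
    ExtClosure P (Set.Ioi a) X :=
  hX.mono (Set.Ioi_subset_Ioi (by linarith))

lemma le_add_one_of_le {a : ℝ} (hX : ExtClosure P (Set.Iic a) X) :
    ExtClosure P (Set.Iic (a + 1)) X :=
  hX.mono (Set.Iic_subset_Iic.2 (by linarith))

end ExtClosure

/-- The triangle `G ⟶ E ⟶ W` truncates `E` into a part of phases `> a` and one of phases `≤ a`. -/
structure IsTrunc (P : ℝ → ObjectProperty C) (a : ℝ) (E G W : C) : Prop where
  isTri : IsTri G E W
  gt : ExtClosure P (Set.Ioi a) G
  le : ExtClosure P (Set.Iic a) W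

end ExtensionClosure

/-! ### Vanishing of Homs and uniqueness of truncations -/

namespace StabilityCondition

variable {C : Type u} [Category.{v} C] [HasZeroObject C] [Preadditive C] [HasShift C ℤ]
  [∀ n : ℤ, (shiftFunctor C n).Additive] [Pretriangulated C] (σ : StabilityCondition C)

lemma mem_shift_one (φ : ℝ) (X : C) (hX : σ.P φ X) : σ.P (φ + (1 : ℤ)) (X⟦(1 : ℤ)⟧) := by
  rw [Int.cast_one]
  exact (σ.shift φ _).2 ⟨X, hX, ⟨Iso.refl _⟩⟩

lemma mem_shift_neg_one (φ : ℝ) (X : C) (hX : σ.P φ X) :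
    σ.P (φ + (-1 : ℤ)) (X⟦(-1 : ℤ)⟧) := by
  obtain ⟨Y, hY, ⟨e⟩⟩ := (σ.shift (φ + (-1 : ℤ)) X).1 (by simpa using hX)
  have := σ.closedUnderIso (φ + (-1 : ℤ))
  exact (σ.P (φ + (-1 : ℤ))).prop_of_iso
    ((shiftEquiv C (1 : ℤ)).unitIso.app Y ≪≫ (shiftFunctor C (-1 : ℤ)).mapIso e.symm) hY

variable {σ} {I J : Set ℝ} {X Y Z : C} {a b : ℝ}

lemma hom_eq_zero_of_extClosure (hIJ : ∀ i ∈ I, ∀ j ∈ J, j < i)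
    (hX : ExtClosure σ.P I X) (hY : ExtClosure σ.P J Y) (f : X ⟶ Y) : f = 0 := by
  induction hX with
  | of_isZero h => exact h.eq_of_src _ _
  | @of_mem φ X h h' =>
    induction hY with
    | of_isZero h => exact h.eq_of_tgt _ _
    | of_mem k k' => exact σ.hom_eq_zero _ _ _ _ (hIJ _ h _ k) h' k' f
    | of_isTri k _ _ k₁ k₂ =>
      obtain ⟨p, q, δ, hT⟩ := k
      obtain ⟨g, rfl⟩ := Triangle.coyoneda_exact₂ _ hT f (k₂ _)
      exact (congrArg (· ≫ p) (k₁ g)).trans zero_comp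
  | of_isTri k _ _ k₁ k₂ =>
    obtain ⟨p, q, δ, hT⟩ := k
    obtain ⟨g, rfl⟩ := Triangle.yoneda_exact₂ _ hT f (k₁ _)
    exact (congrArg (q ≫ ·) (k₂ g)).trans comp_zero

lemma extClosure_gt_of_isTri (h : IsTri X Y Z) (hX : ExtClosure σ.P (Set.Ioi a) X)
    (hY : ExtClosure σ.P (Set.Ioi a) Y) : ExtClosure σ.P (Set.Ioi a) Z :=
  .of_isTri h.rotate hY (hX.shift σ.mem_shift_one fun φ hφ ↦ by
    simp only [Set.mem_Ioi, Int.cast_one] at *; linarith)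

lemma extClosure_le_of_isTri (h : IsTri X Y Z) (hY : ExtClosure σ.P (Set.Iic a) Y)
    (hZ : ExtClosure σ.P (Set.Iic a) Z) : ExtClosure σ.P (Set.Iic a) X :=
  .of_isTri h.invRotate (hZ.shift σ.mem_shift_neg_one fun φ hφ ↦ by
    simp only [Set.mem_Iic, Int.cast_neg, Int.cast_one] at *; linarith) hY

lemma isTrunc_self_gt (hX : ExtClosure σ.P (Set.Ioi a) X) : ∃ W, IsTrunc σ.P a X X W :=
  ⟨_, .of_isZero_right (isZero_zero C) (Iso.refl X), hX, .of_isZero (isZero_zero C)⟩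

lemma isTrunc_self_le (hX : ExtClosure σ.P (Set.Iic a) X) :
    ∃ G, IsZero G ∧ IsTrunc σ.P a X G X :=
  ⟨_, isZero_zero C, .of_isZero_left (isZero_zero C) (Iso.refl X), .of_isZero (isZero_zero C), hX⟩

lemma isTrunc_unique {E G W G' W' : C} (h : IsTrunc σ.P a E G W) (h' : IsTrunc σ.P a E G' W') :
    Nonempty (G ≅ G') := by
  -- Maps from `G₁` to `E` lift to `G₂` because Hom(G₁, W₂) = 0, and the lift is unique because
  -- Hom(G₁, W₂[-1]) = 0.
  have key : ∀ {G₁ W₁ G₂ W₂ : C} (p₁ : G₁ ⟶ E) (p₂ : G₂ ⟶ E) (q₂ : E ⟶ W₂)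
      (δ₂ : W₂ ⟶ G₂⟦(1 : ℤ)⟧), Triangle.mk p₂ q₂ δ₂ ∈ distTriang C → IsTrunc σ.P a E G₁ W₁ →
      IsTrunc σ.P a E G₂ W₂ → (∃ u : G₁ ⟶ G₂, u ≫ p₂ = p₁) ∧ ∀ u : G₁ ⟶ G₂, u ≫ p₂ = 0 → u = 0 := by
    intro G₁ W₁ G₂ W₂ p₁ p₂ q₂ δ₂ hT h₁ h₂
    refine ⟨?_, fun u hu ↦ ?_⟩
    · obtain ⟨u, hu⟩ := Triangle.coyoneda_exact₂ _ hT p₁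
        (hom_eq_zero_of_extClosure (fun i hi j hj ↦ lt_of_le_of_lt hj hi) h₁.gt h₂.le _)
      exact ⟨u, hu.symm⟩
    · obtain ⟨v, hv⟩ := Triangle.coyoneda_exact₂ _ (inv_rot_of_distTriang _ hT) u hu
      have : v = 0 := hom_eq_zero_of_extClosure (J := Set.Iic a)
        (fun i hi j hj ↦ lt_of_le_of_lt hj hi) h₁.gt
        (h₂.le.shift σ.mem_shift_neg_one fun φ hφ ↦ by
          simp only [Set.mem_Iic, Int.cast_neg, Int.cast_one] at *; linarith) v
      rw [hv, this]
      exact zero_comp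
  obtain ⟨p, q, δ, hT⟩ := h.isTri
  obtain ⟨p', q', δ', hT'⟩ := h'.isTri
  obtain ⟨u, hu⟩ := (key p p' q' δ' hT' h h').1
  obtain ⟨w, hw⟩ := (key p' p q δ hT h' h).1
  refine ⟨u, w, ?_, ?_⟩
  · exact sub_eq_zero.1 ((key p p q δ hT h h).2 (u ≫ w - 𝟙 G) (by simp [hu, hw]))
  · exact sub_eq_zero.1 ((key p' p' q' δ' hT' h' h').2 (w ≫ u - 𝟙 G') (by simp [hu, hw]))

lemma isTrunc_charge_unique {E G W G' W' : C} (h : IsTrunc σ.P a E G W)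
    (h' : IsTrunc σ.P a E G' W') : σ.Z (classOf G) = σ.Z (classOf G') := by
  obtain ⟨e⟩ := isTrunc_unique h h'
  rw [classOf_iso e]

lemma hn_obj_gt (H : HNFiltration σ.P X) (k : Fin (H.n + 1))
    (hk : ∀ j : Fin H.n, j.castSucc < k → a < H.phase j) :
    ExtClosure σ.P (Set.Ioi a) (H.obj k) := by
  induction k using Fin.induction with
  | zero => exact .of_isZero H.isZero_obj_zero
  | succ i ih =>
    exact .of_isTri ⟨_, _, _, H.distinguished i⟩
      (ih fun j hj ↦ hk j (hj.trans i.castSucc_lt_succ))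
      (.of_mem (hk i i.castSucc_lt_succ) (H.factor_mem i))

/-! ### Truncations and their central charges -/

section Trunc

variable [IsTriangulated C] {E E' G W : C}

lemma isTrunc_of_gt_sub (h : IsTri X E E') (hX : ExtClosure σ.P (Set.Ioi a) X)
    (hE : IsTrunc σ.P a E' G W) :
    ∃ G', IsTrunc σ.P a E G' W ∧ classOf G' = classOf X + classOf G := by
  obtain ⟨G', h₁, h₂⟩ := h.assoc' hE.isTri
  exact ⟨G', ⟨h₁, .of_isTri h₂ hX hE.gt, hE.le⟩, h₂.classOf_eq⟩

lemma isTrunc_of_le_quot (h : IsTri E' E Y) (hY : ExtClosure σ.P (Set.Iic a) Y)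
    (hE : IsTrunc σ.P a E' G W) : ∃ W', IsTrunc σ.P a E G W' := by
  obtain ⟨W', h₁, h₂⟩ := h.assoc hE.isTri
  exact ⟨W', h₁, hE.gt, .of_isTri h₂ hE.le hY⟩

lemma hn_isTrunc_obj (a : ℝ) (H : HNFiltration σ.P E) (k : Fin (H.n + 1)) :
    ∃ G W, IsTrunc σ.P a (H.obj k) G W ∧ σ.Z (classOf G) =
      ∑ j : Fin H.n, if j.castSucc < k then
        (if a < H.phase j then σ.Z (classOf (H.factor j)) else 0) else 0 := by
  induction k using Fin.induction with
  | zero =>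
    obtain ⟨W, hW⟩ := isTrunc_self_gt (σ := σ) (a := a) (.of_isZero H.isZero_obj_zero)
    exact ⟨_, _, hW, by simp [classOf_isZero H.isZero_obj_zero]⟩
  | succ i ih =>
    obtain ⟨G, W, hGW, hZ⟩ := ih
    have hT : IsTri (H.obj i.castSucc) (H.obj i.succ) (H.factor i) := ⟨_, _, _, H.distinguished i⟩
    have hsum : (∑ j : Fin H.n, if j.castSucc < i.succ then
        (if a < H.phase j then σ.Z (classOf (H.factor j)) else 0) else 0) =
        σ.Z (classOf G) + if a < H.phase i then σ.Z (classOf (H.factor i)) else 0 := by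
      have hsingle : (if a < H.phase i then σ.Z (classOf (H.factor i)) else 0) =
          ∑ j : Fin H.n, if j = i then
            (if a < H.phase j then σ.Z (classOf (H.factor j)) else 0) else 0 := by simp
      rw [hZ, hsingle, ← Finset.sum_add_distrib]
      refine Finset.sum_congr rfl fun j _ ↦ ?_
      rcases lt_trichotomy j i with h | h | h
      · rw [if_pos (by simp only [Fin.lt_def, Fin.val_castSucc, Fin.val_succ] at *; omega),
          if_pos (c := j.castSucc < i.castSucc) (by simpa using h), if_neg h.ne, add_zero]
      · subst h
        simp
      · rw [if_neg (by simp only [Fin.lt_def, Fin.val_castSucc, Fin.val_succ] at *; omega),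
          if_neg (c := j.castSucc < i.castSucc) (by simpa using h.le), if_neg h.ne', add_zero]
    rw [hsum]
    split_ifs with hi
    -- Phases decrease along the filtration, so all earlier factors also have phase `> a`: both
    -- objects are their own truncations. Otherwise the new factor only enlarges the part of phases
    -- `≤ a`.
    · have hgt : ∀ j : Fin H.n, j.castSucc < i.castSucc → a < H.phase j := fun j hj ↦
        hi.trans (H.phase_strictAnti (by simpa using hj))
      have h₁ := hn_obj_gt H _ hgt
      obtain ⟨W₁, hW₁⟩ := isTrunc_self_gt h₁
      obtain ⟨W₂, hW₂⟩ := isTrunc_self_gt (ExtClosure.of_isTri hT h₁ (.of_mem hi (H.factor_mem i)))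
      exact ⟨_, _, hW₂, by
        rw [isTrunc_charge_unique hGW hW₁, hT.classOf_eq, map_add]⟩
    · obtain ⟨W', hW'⟩ := isTrunc_of_le_quot hT (.of_mem (not_lt.1 hi) (H.factor_mem i)) hGW
      exact ⟨_, _, hW', by simp⟩

lemma hn_isTrunc (a : ℝ) (H : HNFiltration σ.P E) :
    ∃ G W, IsTrunc σ.P a E G W ∧ σ.Z (classOf G) =
      ∑ j : Fin H.n, if a < H.phase j then σ.Z (classOf (H.factor j)) else 0 := by
  obtain ⟨G, W, h, hZ⟩ := hn_isTrunc_obj a H (Fin.last _)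
  refine ⟨G, W, ⟨h.isTri.congr (Iso.refl _) H.lastIso (Iso.refl _), h.gt, h.le⟩, ?_⟩
  simpa [Fin.castSucc_lt_last] using hZ

variable (σ) in
lemma exists_isTrunc (a : ℝ) (E : C) : ∃ G W, IsTrunc σ.P a E G W := by
  by_cases hE : IsZero E
  · obtain ⟨W, hW⟩ := isTrunc_self_gt (σ := σ) (a := a) (.of_isZero hE)
    exact ⟨_, _, hW⟩
  · obtain ⟨H⟩ := σ.exists_HN E hE
    obtain ⟨G, W, h, -⟩ := hn_isTrunc a H
    exact ⟨G, W, h⟩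

variable (σ) in
/-- The central charge of the part of `E` of phases `> a`. -/
def truncCharge (a : ℝ) (E : C) : ℂ := σ.Z (classOf (σ.exists_isTrunc a E).choose)

lemma truncCharge_eq (h : IsTrunc σ.P a E G W) : σ.truncCharge a E = σ.Z (classOf G) :=
  isTrunc_charge_unique (σ.exists_isTrunc a E).choose_spec.choose_spec h

lemma truncCharge_of_gt (h : ExtClosure σ.P (Set.Ioi a) E) :
    σ.truncCharge a E = σ.Z (classOf E) := by
  obtain ⟨W, hW⟩ := isTrunc_self_gt h
  exact truncCharge_eq hW

lemma truncCharge_of_le (h : ExtClosure σ.P (Set.Iic a) E) : σ.truncCharge a E = 0 := by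
  obtain ⟨G, hG, hW⟩ := isTrunc_self_le h
  rw [truncCharge_eq hW, classOf_isZero hG, map_zero]

lemma truncCharge_of_gt_sub (h : IsTri X E E') (hX : ExtClosure σ.P (Set.Ioi a) X) :
    σ.truncCharge a E = σ.Z (classOf X) + σ.truncCharge a E' := by
  obtain ⟨G, W, hG⟩ := σ.exists_isTrunc a E'
  obtain ⟨G', hG', h'⟩ := isTrunc_of_gt_sub h hX hG
  rw [truncCharge_eq hG, truncCharge_eq hG', h', map_add]

lemma truncCharge_of_le_quot (h : IsTri E' E Y) (hY : ExtClosure σ.P (Set.Iic a) Y) :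
    σ.truncCharge a E = σ.truncCharge a E' := by
  obtain ⟨G, W, hG⟩ := σ.exists_isTrunc a E'
  obtain ⟨W', hG'⟩ := isTrunc_of_le_quot h hY hG
  rw [truncCharge_eq hG, truncCharge_eq hG']

end Trunc

/-! ### Heights and the sine integral -/

/-- The height `Im (exp(-iπa) z)` of `z` above the line of phase `a`. -/
def height (a : ℝ) : ℂ →+ ℝ :=
  Complex.imAddGroupHom.comp (AddMonoidHom.mulLeft (Complex.exp (-(Complex.I * Real.pi * a))))

lemma height_apply (a : ℝ) (z : ℂ) :
    height a z = (Complex.exp (-(Complex.I * Real.pi * a)) * z).im := rfl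

lemma height_add_one (a : ℝ) (z : ℂ) : height (a + 1) z = -height a z := by
  have : Complex.exp (-(Complex.I * Real.pi * ((a + 1 : ℝ) : ℂ))) =
      -Complex.exp (-(Complex.I * Real.pi * a)) := by
    rw [← Complex.exp_sub_pi_mul_I]
    congr 1
    push_cast
    ring
  rw [height_apply, height_apply, this, neg_mul, Complex.neg_im]

variable (σ) in
lemma height_of_mem (a : ℝ) {φ : ℝ} (hX : σ.P φ X) :
    height a (σ.Z (classOf X)) = ‖σ.Z (classOf X)‖ * Real.sin (Real.pi * (φ - a)) := by
  by_cases h0 : IsZero X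
  · simp [classOf_isZero h0]
  · obtain ⟨m, hm, h⟩ := σ.central_charge φ X hX h0
    have hn : ‖σ.Z (classOf X)‖ = m := by
      have : Complex.I * Real.pi * φ = ((Real.pi * φ : ℝ) : ℂ) * Complex.I := by
        push_cast
        ring
      rw [h, this, norm_mul, Complex.norm_exp_ofReal_mul_I, mul_one, Complex.norm_real,
        Real.norm_of_nonneg hm.le]
    have he : Complex.exp (-(Complex.I * Real.pi * a)) * (m * Complex.exp (Complex.I * Real.pi * φ)) =
        m * Complex.exp (((Real.pi * (φ - a) : ℝ) : ℂ) * Complex.I) := by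
      rw [mul_left_comm, ← Complex.exp_add]
      congr 2
      push_cast
      ring
    rw [hn, h, height_apply, he, Complex.im_ofReal_mul, Complex.exp_ofReal_mul_I_im]

/-- The function `sin (π u)` on the interval `0 < u ≤ 1`, extended by zero. -/
def sineBump : ℝ → ℝ := (Set.Ioc 0 1).indicator fun u ↦ Real.sin (Real.pi * u)

lemma sineBump_nonneg (u : ℝ) : 0 ≤ sineBump u :=
  Set.indicator_nonneg (fun _ hu ↦ Real.sin_nonneg_of_nonneg_of_le_pi
    (mul_nonneg Real.pi_pos.le hu.1.le) (mul_le_of_le_one_right Real.pi_pos.le hu.2)) u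

lemma sineBump_mul_exp (t : ℝ) : (fun u ↦ sineBump u * Real.exp (-(u * t))) =
    (Set.Ioc 0 1).indicator fun u ↦ Real.sin (Real.pi * u) * Real.exp (-(u * t)) := by
  ext u
  by_cases hu : u ∈ Set.Ioc (0 : ℝ) 1 <;> simp [sineBump, hu]

lemma integrable_sineBump_mul_exp (t : ℝ) :
    MeasureTheory.Integrable fun u ↦ sineBump u * Real.exp (-(u * t)) := by
  rw [sineBump_mul_exp, MeasureTheory.integrable_indicator_iff measurableSet_Ioc]
  exact (Continuous.integrableOn_Icc (by fun_prop)).mono_set Set.Ioc_subset_Icc_self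

lemma integral_sineBump_mul_exp_pos (t : ℝ) : 0 < ∫ u, sineBump u * Real.exp (-(u * t)) := by
  rw [sineBump_mul_exp, MeasureTheory.integral_indicator measurableSet_Ioc,
    ← intervalIntegral.integral_of_le zero_le_one]
  refine intervalIntegral.intervalIntegral_pos_of_pos_on
    (Continuous.intervalIntegrable (by fun_prop) _ _) (fun u hu ↦ ?_) zero_lt_one
  exact mul_pos (Real.sin_pos_of_pos_of_lt_pi (mul_pos Real.pi_pos hu.1)
    (mul_lt_of_lt_one_right Real.pi_pos hu.2)) (Real.exp_pos _)

lemma sineBump_sub_mul_exp (t φ : ℝ) : (fun a ↦ sineBump (φ - a) * Real.exp (a * t)) =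
    fun a ↦ Real.exp (φ * t) * (sineBump (φ - a) * Real.exp (-((φ - a) * t))) := by
  ext a
  rw [mul_left_comm, ← Real.exp_add]
  ring_nf

lemma integrable_sineBump_sub (t φ : ℝ) :
    MeasureTheory.Integrable fun a ↦ sineBump (φ - a) * Real.exp (a * t) := by
  rw [sineBump_sub_mul_exp]
  exact ((integrable_sineBump_mul_exp t).comp_sub_left φ).const_mul _

lemma integral_sineBump_sub (t φ : ℝ) : ∫ a, sineBump (φ - a) * Real.exp (a * t) =
    Real.exp (φ * t) * ∫ u, sineBump u * Real.exp (-(u * t)) := by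
  rw [sineBump_sub_mul_exp, MeasureTheory.integral_const_mul,
    MeasureTheory.integral_sub_left_eq_self (fun u ↦ sineBump u * Real.exp (-(u * t)))]

/-! ### Subadditivity heart by heart -/

section Subadditivity

variable [IsTriangulated C] {D E F : C}

variable (σ) in
/-- The height of the part of `E` of phases in `(a, a + 1]`, which is the cohomology of `E`
in degree zero with respect to the heart `P((a, a + 1])`. -/
def heartHeight (a : ℝ) (E : C) : ℝ :=
  height a (σ.truncCharge a E - σ.truncCharge (a + 1) E)

/-- A factor survives in the difference of the two truncations exactly when its phase lies in (a,
a+1]. -/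
lemma heartHeight_eq_sum (a : ℝ) (H : HNFiltration σ.P E) :
    σ.heartHeight a E = ∑ j, ‖σ.Z (classOf (H.factor j))‖ * sineBump (H.phase j - a) := by
  obtain ⟨G, W, h, hG⟩ := hn_isTrunc a H
  obtain ⟨G', W', h', hG'⟩ := hn_isTrunc (a + 1) H
  rw [heartHeight, truncCharge_eq h, truncCharge_eq h', hG, hG', ← Finset.sum_sub_distrib, map_sum]
  refine Finset.sum_congr rfl fun j _ ↦ ?_
  by_cases h₁ : a < H.phase j
  · by_cases h₂ : a + 1 < H.phase j
    · have : H.phase j - a ∉ Set.Ioc (0 : ℝ) 1 := fun h ↦ by linarith [h.2]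
      simp [h₁, h₂, sineBump, this]
    · have : H.phase j - a ∈ Set.Ioc (0 : ℝ) 1 := ⟨by linarith, by linarith⟩
      simp [h₁, h₂, sineBump, this, height_of_mem σ a (H.factor_mem j)]
  · have h₂ : ¬ a + 1 < H.phase j := fun h ↦ h₁ (by linarith)
    have : H.phase j - a ∉ Set.Ioc (0 : ℝ) 1 := fun h ↦ by linarith [h.1]
    simp [h₁, h₂, sineBump, this]

lemma heartHeight_isZero (a : ℝ) (hE : IsZero E) : σ.heartHeight a E = 0 := by
  rw [heartHeight, truncCharge_of_le (.of_isZero hE), truncCharge_of_le (.of_isZero hE), sub_zero,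
    map_zero]

lemma heartHeight_nonneg (a : ℝ) (E : C) : 0 ≤ σ.heartHeight a E := by
  by_cases hE : IsZero E
  · exact (heartHeight_isZero a hE).ge
  · obtain ⟨H⟩ := σ.exists_HN E hE
    rw [heartHeight_eq_sum a H]
    exact Finset.sum_nonneg fun j _ ↦ mul_nonneg (norm_nonneg _) (sineBump_nonneg _)

lemma height_nonneg (hgt : ExtClosure σ.P (Set.Ioi a) E)
    (hle : ExtClosure σ.P (Set.Iic (a + 1)) E) : 0 ≤ height a (σ.Z (classOf E)) := by
  have := heartHeight_nonneg (σ := σ) a E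
  rwa [heartHeight, truncCharge_of_gt hgt, truncCharge_of_le hle, sub_zero] at this

lemma heartHeight_of_gt_sub (h : IsTri D E F) (hD : ExtClosure σ.P (Set.Ioi (a + 1)) D) :
    σ.heartHeight a E = σ.heartHeight a F := by
  rw [heartHeight, heartHeight, truncCharge_of_gt_sub h hD,
    truncCharge_of_gt_sub h (ExtClosure.gt_of_gt_add_one hD), add_sub_add_left_eq_sub]

lemma heartHeight_of_le_quot (h : IsTri D E F) (hF : ExtClosure σ.P (Set.Iic a) F) :
    σ.heartHeight a E = σ.heartHeight a D := by
  rw [heartHeight, heartHeight, truncCharge_of_le_quot h hF,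
    truncCharge_of_le_quot h (ExtClosure.le_add_one_of_le hF)]

/-- Subadditivity when the middle term lies in the heart `P((a, a + 1])`. -/
lemma heartHeight_le_of_heart (h : IsTri D E F) (hE : ExtClosure σ.P (Set.Ioi a) E)
    (hE' : ExtClosure σ.P (Set.Iic (a + 1)) E) (hD : ExtClosure σ.P (Set.Iic (a + 1)) D)
    (hF : ExtClosure σ.P (Set.Ioi a) F) :
    σ.heartHeight a E ≤ σ.heartHeight a D + σ.heartHeight a F := by
  obtain ⟨G, W, hG⟩ := σ.exists_isTrunc a D
  obtain ⟨X, Y, hX⟩ := σ.exists_isTrunc (a + 1) F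
  have hD' : ExtClosure σ.P (Set.Ioi (a - 1)) D :=
    .of_isTri h.invRotate (hF.shift σ.mem_shift_neg_one fun φ hφ ↦ by
      simp only [Set.mem_Ioi, Int.cast_neg, Int.cast_one] at *; linarith)
      (hE.mono (Set.Ioi_subset_Ioi (by linarith)))
  have hF' : ExtClosure σ.P (Set.Iic (a + 1 + 1)) F :=
    .of_isTri h.rotate (ExtClosure.le_add_one_of_le hE') (hD.shift σ.mem_shift_one fun φ hφ ↦ by
      simp only [Set.mem_Iic, Int.cast_one] at *; linarith)
  -- `W` has phases in (a-1, a] and, below, `X` has phases in (a+1, a+2]; moving `a` by one flips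
  -- the sign of the height.
  have hW : height a (σ.Z (classOf W)) ≤ 0 := by
    have h₁ := extClosure_gt_of_isTri hG.isTri (hG.gt.mono (Set.Ioi_subset_Ioi (by linarith))) hD'
    have h₂ := height_nonneg h₁ (by simpa using hG.le)
    have h₃ := height_add_one (a - 1) (σ.Z (classOf W))
    rw [sub_add_cancel] at h₃
    linarith
  have hXn : height a (σ.Z (classOf X)) ≤ 0 := by
    have h₁ := extClosure_le_of_isTri hX.isTri hF' (ExtClosure.le_add_one_of_le hX.le)
    have h₂ := height_nonneg hX.gt h₁
    rw [height_add_one] at h₂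
    linarith
  -- With [E] = [G] + [W] + [F], the claim becomes height(W) + height(X) ≤ 0.
  rw [heartHeight, heartHeight, heartHeight, truncCharge_of_gt hE, truncCharge_of_le hE',
    truncCharge_of_le hD, truncCharge_of_gt hF, truncCharge_eq hG, truncCharge_eq hX,
    h.classOf_eq, hG.isTri.classOf_eq]
  simp only [map_add, map_sub, map_zero]
  linarith

/-- The numerical form of the half-exactness of cohomology. -/
lemma heartHeight_le (a : ℝ) (h : IsTri D E F) :
    σ.heartHeight a E ≤ σ.heartHeight a D + σ.heartHeight a F := by
  -- Cut `F` to phases `> a` and `D` to phases `≤ a + 1`, adjusting `E`; then cut the middle term to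
  -- phases in (a, a+1], adjusting the ends. Each piece removed has phases `≤ a` as a quotient or `>
  -- a + 1` as a subobject, so no height changes.
  obtain ⟨F₁, Fw, hF⟩ := σ.exists_isTrunc a F
  obtain ⟨E₁, hE₁, h₁⟩ := h.assoc' hF.isTri
  obtain ⟨Dg, D₂, hD⟩ := σ.exists_isTrunc (a + 1) D
  obtain ⟨E₂, hE₂, h₂⟩ := h₁.assoc hD.isTri
  obtain ⟨G, W, hG⟩ := σ.exists_isTrunc a E₂
  obtain ⟨K, h₃, hK⟩ := h₂.pullback hG.isTri
  obtain ⟨X, Q, hQ⟩ := σ.exists_isTrunc (a + 1) G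
  obtain ⟨L, h₄, hL⟩ := h₃.pushout hQ.isTri
  have key := heartHeight_le_of_heart h₄
    (extClosure_gt_of_isTri hQ.isTri (ExtClosure.gt_of_gt_add_one hQ.gt) hG.gt) hQ.le
    (extClosure_le_of_isTri hK hD.le (ExtClosure.le_add_one_of_le hG.le))
    (extClosure_gt_of_isTri hL (ExtClosure.gt_of_gt_add_one hQ.gt) hF.gt)
  rwa [heartHeight_of_le_quot hE₁ hF.le, heartHeight_of_gt_sub hE₂ hD.gt,
    heartHeight_of_le_quot hG.isTri hG.le, heartHeight_of_gt_sub hQ.isTri hQ.gt,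
    heartHeight_of_gt_sub hD.isTri hD.gt, heartHeight_of_le_quot hK hG.le,
    heartHeight_of_le_quot hF.isTri hF.le, heartHeight_of_gt_sub hL hQ.gt]

variable (σ) in
lemma integrable_heartHeight (t : ℝ) (E : C) :
    MeasureTheory.Integrable fun a ↦ σ.heartHeight a E * Real.exp (a * t) := by
  by_cases hE : IsZero E
  · simp [heartHeight_isZero _ hE]
  · obtain ⟨H⟩ := σ.exists_HN E hE
    simp only [heartHeight_eq_sum _ H, Finset.sum_mul, mul_assoc]
    exact MeasureTheory.integrable_finsetSum _ fun j _ ↦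
      (integrable_sineBump_sub t (H.phase j)).const_mul _

variable (σ) in
/-- The mass is an integral over all hearts `P((a, a + 1])`. -/
lemma integral_heartHeight (t : ℝ) (E : C) :
    ∫ a, σ.heartHeight a E * Real.exp (a * t) =
      σ.mass t E * ∫ u, sineBump u * Real.exp (-(u * t)) := by
  by_cases hE : IsZero E
  · simp [heartHeight_isZero _ hE, mass, hE]
  · rw [mass, dif_neg hE, massOfHN, Finset.sum_mul]
    simp only [heartHeight_eq_sum _ (σ.exists_HN E hE).some, Finset.sum_mul, mul_assoc]
    rw [MeasureTheory.integral_finsetSum _ fun j _ ↦ (integrable_sineBump_sub t _).const_mul _]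
    refine Finset.sum_congr rfl fun j _ ↦ ?_
    rw [MeasureTheory.integral_const_mul, integral_sineBump_sub]

end Subadditivity

end StabilityCondition

end BridgelandStability

end

theorem proposition3p5 {C : Type u} [Category.{v} C] [HasZeroObject C] [Preadditive C]
    [HasShift C ℤ] [∀ n : ℤ, (shiftFunctor C n).Additive] [Pretriangulated C] [IsTriangulated C]
    (σ : BridgelandStability.StabilityCondition C) (D E F : C)
    (f : D ⟶ E) (g : E ⟶ F) (h : F ⟶ D⟦(1 : ℤ)⟧)
    (hT : Triangle.mk f g h ∈ distTriang C) (t : ℝ) :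
    σ.mass t E ≤ σ.mass t D + σ.mass t F := by
  refine le_of_mul_le_mul_right ?_
    (BridgelandStability.StabilityCondition.integral_sineBump_mul_exp_pos t)
  rw [add_mul, ← σ.integral_heartHeight, ← σ.integral_heartHeight, ← σ.integral_heartHeight,
    ← MeasureTheory.integral_add (σ.integrable_heartHeight t D) (σ.integrable_heartHeight t F)]
  refine MeasureTheory.integral_mono (σ.integrable_heartHeight t E)
    ((σ.integrable_heartHeight t D).add (σ.integrable_heartHeight t F)) fun a ↦ ?_
  rw [← add_mul]
  exact mul_le_mul_of_nonneg_right
    (BridgelandStability.StabilityCondition.heartHeight_le a ⟨f, g, h, hT⟩) (Real.exp_pos _).le
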